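/- Let $m>0$ and, for real $x,t$, let $$G(x,t)=\frac1\pi\int_0^\infty e^{-i(\sqrt{m^2+p^2}-m)\,t}\cos(px)\,dp .$$ The integrand does not decay, and the oscillatory integral is regularized by $t\to t-i0^+$, that is, $$G(x,t)=\lim_{\varepsilon\to0^+}\frac1\pi\int_0^\infty e^{-i(\sqrt{m^2+p^2}-m)(t-i\varepsilon)}\cos(px)\,dp ,$$ where the integral converges absolutely for every $\varepsilon>0$. Then the limit exists in the following two cases, with the values given. (i) Outside the light cone, i.e. for all real $x,t$ with $x^2>t^2$, $$G(x,t)=\frac{i\,m\,t\,e^{imt}}{\pi\sqrt{x^2-t^2}}\;K_1\!\left(m\sqrt{x^2-t^2}\right).$$ (ii) Inside the light cone at positive times, i.e. for all real $x,t$ with $t>0$ and $x^2<t^2$, $$G(x,t)=-\frac{m\,t\,e^{imt}}{2\sqrt{t^2-x^2}}\;H_1^{(1)}\!\left(-m\sqrt{t^2-x^2}\right).$$ Here $K_1$ is the modified Bessel function of the second kind and $H_1^{(1)}=J_1+iY_1$ is the Hankel function of the first kind, taken on its principal branch, so that the negative real argument in (ii) has $\arg=\pi$. -/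

import Mathlib

open Real MeasureTheory Filter Topology

noncomputable section

namespace Salpeter

/-- The Salpeter Hamiltonian `H(p) = √(m² + p²) - m` (units with `ħ = c = 1`). -/
def hamiltonian (m p : ℝ) : ℝ := √(m ^ 2 + p ^ 2) - m

/-- The integrand `e^{-i H(p) τ} cos(p x)`, for a complex time `τ`. -/
def integrand (m x : ℝ) (τ : ℂ) (p : ℝ) : ℂ :=
  Complex.exp (-Complex.I * (hamiltonian m p : ℂ) * τ) * (Real.cos (p * x) : ℂ)

/-- `(1/π) ∫_0^∞ e^{-i H(p) τ} cos(p x) dp`; the integral converges absolutely if `Im τ < 0`. -/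
def complexTimeIntegral (m x : ℝ) (τ : ℂ) : ℂ :=
  (1 / (π : ℂ)) * ∫ p in Set.Ioi (0 : ℝ), integrand m x τ p

/-- `G` is the value at `(x, t)` of the propagator `(1/π) ∫_0^∞ e^{-i H(p) t} cos(p x) dp`.
The integrand does not decay in `p`, so the oscillatory integral is regularized by giving the time
a vanishing negative imaginary part, `t → t - i0⁺`: for each `ε > 0` the integral at time `t - iε`
converges absolutely, and its value tends to `G` as `ε → 0⁺`. -/
def IsPropagatorValue (m x t : ℝ) (G : ℂ) : Prop :=
  (∀ ε : ℝ, 0 < ε →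
    IntegrableOn (integrand m x ((t : ℂ) - (ε : ℂ) * Complex.I)) (Set.Ioi (0 : ℝ))) ∧
  Tendsto (fun ε : ℝ => complexTimeIntegral m x ((t : ℂ) - (ε : ℂ) * Complex.I))
    (𝓝[>] (0 : ℝ)) (𝓝 G)

/-- The modified Bessel function of the second kind `K_ν(z)`, for `Re z > 0`:
`K_ν(z) = ∫_0^∞ e^{-z cosh u} cosh(ν u) du`. -/
def besselK (ν z : ℂ) : ℂ :=
  ∫ u in Set.Ioi (0 : ℝ), Complex.exp (-z * (Real.cosh u : ℂ)) * Complex.cosh (ν * (u : ℂ))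

/-- The Bessel function of the first kind of order `n ∈ ℕ`:
`J_n(z) = (z/2)^n ∑_k (-z²/4)^k / (k! (n+k)!)`. -/
def besselJ (n : ℕ) (z : ℂ) : ℂ :=
  (z / 2) ^ n * ∑' k : ℕ, (-(z ^ 2) / 4) ^ k / ((k.factorial : ℂ) * ((n + k).factorial : ℂ))

/-- The Bessel function of the second kind of order `n ∈ ℕ`, principal branch (the logarithm is the
principal one, with `-π < arg z ≤ π`), for `z ≠ 0`:
`Y_n(z) = -(1/π) (z/2)^{-n} ∑_{k<n} ((n-k-1)!/k!) (z²/4)^k + (2/π) log(z/2) J_n(z)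
  - (1/π) (z/2)^n ∑_k (ψ(k+1) + ψ(n+k+1)) (-z²/4)^k / (k! (n+k)!)`,
where `ψ = Γ'/Γ`. In the finite sum `k < n`, so the subtraction of naturals is exact. -/
def besselY (n : ℕ) (z : ℂ) : ℂ :=
  -(1 / (π : ℂ)) * (z / 2)⁻¹ ^ n *
      ∑ k ∈ Finset.range n,
        ((n - k - 1).factorial : ℂ) / (k.factorial : ℂ) * (z ^ 2 / 4) ^ k
    + (2 / (π : ℂ)) * Complex.log (z / 2) * besselJ n z
    - (1 / (π : ℂ)) * (z / 2) ^ n *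
      ∑' k : ℕ, (Complex.digamma ((k : ℂ) + 1) + Complex.digamma ((n : ℂ) + (k : ℂ) + 1)) *
        ((-(z ^ 2) / 4) ^ k / ((k.factorial : ℂ) * ((n + k).factorial : ℂ)))

/-- The Hankel function of the first kind `H_n^{(1)} = J_n + i Y_n`, principal branch. -/
def hankelH1 (n : ℕ) (z : ℂ) : ℂ := besselJ n z + Complex.I * besselY n z

end Salpeter

end

/-!
Write `s = i(t - iε)`. Substituting `p = m sinh u` turns the Fourier integral of
`e^{-s √(m² + p²)}` into minus the `s`-derivative of `∫ e^{-m (s cosh u - i x sinh u)} du`. For real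
exponents a translation of `u` (a Lorentz boost) reduces that integral to `2 K_0(m √(s² + x²))`, and
the identity theorem in the two light-cone variables `s ± i x` extends this to `Re s > 0`. Hence the
regularized propagator equals `i m τ e^{imτ} / (π √(s² + x²)) · K_1(m √(s² + x²))` with
`τ = t - iε`.

As `ε → 0⁺`, inside the light cone the square root tends to the imaginary axis, where the integral
defining `K_1` no longer converges. So `K_1` is continued to the slit plane by its logarithmic
series. That series is identified on `Re z > 0` through the differential equation: a solution of
the modified Bessel equation of order zero is determined by its asymptotics
`c - log r + o(1)` as `r → 0⁺`. On the positive imaginary axis the continued `K_1` is, term by term,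
`-(π/2) H_1^{(1)}` at a negative real argument.
-/

namespace Salpeter

theorem isOpen_setOf_re_pos : IsOpen {z : ℂ | 0 < z.re} :=
  isOpen_lt continuous_const Complex.continuous_re

theorem isPreconnected_setOf_re_pos : IsPreconnected {z : ℂ | 0 < z.re} :=
  (convex_halfSpace_re_gt 0).isPreconnected

section Laplace

theorem eqOn_re_pos_of_eq_ofReal {E : Type*} [NormedAddCommGroup E] [NormedSpace ℂ E]
    [CompleteSpace E] {f g : ℂ → E} (hf : DifferentiableOn ℂ f {z | 0 < z.re})
    (hg : DifferentiableOn ℂ g {z | 0 < z.re}) (hfg : ∀ r : ℝ, 0 < r → f r = g r) :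
    Set.EqOn f g {z | 0 < z.re} := by
  have hone : (1 : ℂ) ∈ {z : ℂ | 0 < z.re} := by simp
  refine (hf.analyticOnNhd isOpen_setOf_re_pos).eqOn_of_preconnected_of_frequently_eq
    (hg.analyticOnNhd isOpen_setOf_re_pos) isPreconnected_setOf_re_pos hone ?_
  have hlim : Tendsto (fun r : ℝ => (r : ℂ)) (𝓝[>] 1) (𝓝[≠] 1) :=
    tendsto_nhdsWithin_iff.2 ⟨
      (Complex.continuous_ofReal.tendsto' 1 1 Complex.ofReal_one).mono_left nhdsWithin_le_nhds,
      by
        filter_upwards [self_mem_nhdsWithin] with r hr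
        simpa using (Set.mem_Ioi.1 hr).ne'⟩
  refine hlim.frequently (Eventually.frequently ?_)
  filter_upwards [self_mem_nhdsWithin] with r hr
  exact hfg r (one_pos.trans hr)

theorem norm_cexp_neg_mul_ofReal (z : ℂ) (x : ℝ) :
    ‖Complex.exp (-z * x)‖ = rexp (-z.re * x) := by
  rw [Complex.norm_exp, Complex.re_mul_ofReal, Complex.neg_re]

theorem mul_exp_neg_mul_le {c : ℝ} (hc : 0 < c) (x : ℝ) :
    x * rexp (-c * x) ≤ 2 / c * rexp (-(c / 2) * x) := by
  have hsplit : rexp (-c * x) = rexp (-(c / 2 * x)) * rexp (-(c / 2) * x) := by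
    rw [← Real.exp_add]; ring_nf
  have hle : c / 2 * x * rexp (-(c / 2 * x)) ≤ 1 := by
    rw [Real.exp_neg, ← div_eq_mul_inv, div_le_one (Real.exp_pos _)]
    linarith [Real.add_one_le_exp (c / 2 * x)]
  calc x * rexp (-c * x)
      = 2 / c * (c / 2 * x * rexp (-(c / 2 * x))) * rexp (-(c / 2) * x) := by
        rw [hsplit]; field_simp
    _ ≤ 2 / c * 1 * rexp (-(c / 2) * x) := by gcongr
    _ = _ := by rw [mul_one]

variable {α E : Type*} [MeasurableSpace α] {μ : Measure α} [NormedAddCommGroup E]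
  [NormedSpace ℂ E] {X : α → ℝ} {φ : α → E}

theorem hasDerivAt_integral_cexp_neg_mul_smul (hX : AEMeasurable X μ) (hX0 : ∀ u, 0 ≤ X u)
    (hint : ∀ z : ℂ, 0 < z.re → Integrable (fun u => Complex.exp (-z * X u) • φ u) μ)
    {z : ℂ} (hz : 0 < z.re) :
    Integrable (fun u => Complex.exp (-z * X u) • (X u : ℂ) • φ u) μ ∧
      HasDerivAt (fun z : ℂ => ∫ u, Complex.exp (-z * X u) • φ u ∂μ)
        (-∫ u, Complex.exp (-z * X u) • (X u : ℂ) • φ u ∂μ) z := by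
  set c := z.re / 2
  have hc0 : 0 < c := half_pos hz
  have hnhds : {w : ℂ | c < w.re} ∈ 𝓝 z :=
    (isOpen_lt continuous_const Complex.continuous_re).mem_nhds (half_lt_self hz)
  have hφ : AEStronglyMeasurable φ μ := by
    have h := (hint 1 (by simp)).aestronglyMeasurable
    refine (AEStronglyMeasurable.smul (f := fun u => Complex.exp (X u)) (by fun_prop) h).congr
      (ae_of_all _ fun u => ?_)
    simp only [Pi.smul_apply', smul_smul, ← Complex.exp_add]
    simp
  have hbound : ∀ u, ∀ w ∈ {w : ℂ | c < w.re}, ‖-(Complex.exp (-w * X u) • (X u : ℂ) • φ u)‖ ≤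
      2 / c * ‖Complex.exp (-((c / 2 : ℝ) : ℂ) * X u) • φ u‖ := by
    intro u w hw
    have hw : c ≤ w.re := le_of_lt hw
    simp only [norm_neg, norm_smul, norm_cexp_neg_mul_ofReal, Complex.norm_of_nonneg (hX0 u),
      Complex.ofReal_re, ← mul_assoc]
    refine mul_le_mul_of_nonneg_right ?_ (norm_nonneg _)
    calc rexp (-w.re * X u) * X u ≤ rexp (-c * X u) * X u := by
          gcongr <;> exact hX0 u
      _ ≤ 2 / c * rexp (-(c / 2) * X u) := by
          rw [mul_comm]
          exact mul_exp_neg_mul_le hc0 (X u)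
  have h := hasDerivAt_integral_of_dominated_loc_of_deriv_le (μ := μ)
    (F := fun (w : ℂ) u => Complex.exp (-w * X u) • φ u)
    (F' := fun (w : ℂ) u => -(Complex.exp (-w * X u) • (X u : ℂ) • φ u)) hnhds
    (Eventually.of_forall fun w => by fun_prop) (hint z hz) (by fun_prop) (ae_of_all _ hbound)
    (((hint _ (by simpa using hc0)).norm).const_mul _)
    (ae_of_all _ fun u w _ => by
      refine (((hasDerivAt_id w).neg.mul_const (X u : ℂ)).cexp.smul_const (φ u)).congr_deriv ?_
      simp [mul_smul])
  rw [← integral_neg]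
  exact ⟨by simpa using h.1.neg, h.2⟩

end Laplace

section CoshMoment

/-- The moments `∫_0^∞ e^{-z cosh u} coshⁿ u du`, for `Re z > 0`. The Bessel functions `K_0` and
`K_1` are the moments of order `0` and `1`. -/
noncomputable def coshMoment (n : ℕ) (z : ℂ) : ℂ :=
  ∫ u in Set.Ioi (0 : ℝ), Complex.exp (-z * Real.cosh u) * (Real.cosh u : ℂ) ^ n

theorem besselK_zero_eq_coshMoment : besselK 0 = coshMoment 0 := by
  funext z
  simp [besselK, coshMoment]

theorem besselK_one_eq_coshMoment : besselK 1 = coshMoment 1 := by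
  funext z
  simp [besselK, coshMoment]

theorem sq_div_four_le_cosh (u : ℝ) : u ^ 2 / 4 ≤ Real.cosh u := by
  have h := Real.quadratic_le_exp_of_nonneg (abs_nonneg u)
  rw [sq_abs] at h
  rw [← Real.cosh_abs, Real.cosh_eq]
  linarith [Real.exp_pos (-|u|), abs_nonneg u]

theorem integrable_exp_neg_mul_cosh {c : ℝ} (hc : 0 < c) :
    Integrable fun u : ℝ => rexp (-c * Real.cosh u) := by
  refine (integrable_exp_neg_mul_sq (b := c / 4) (by positivity)).mono' (by fun_prop)
    (ae_of_all _ fun u => ?_)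
  rw [Real.norm_of_nonneg (Real.exp_pos _).le, Real.exp_le_exp]
  linarith [mul_le_mul_of_nonneg_left (sq_div_four_le_cosh u) hc.le]

theorem integrable_cexp_neg_mul_cosh_mul_pow (n : ℕ) {z : ℂ} (hz : 0 < z.re) :
    Integrable fun u : ℝ => Complex.exp (-z * Real.cosh u) * (Real.cosh u : ℂ) ^ n := by
  induction n generalizing z with
  | zero =>
    refine (integrable_exp_neg_mul_cosh hz).mono' (by fun_prop) (ae_of_all _ fun u => ?_)
    rw [pow_zero, mul_one, norm_cexp_neg_mul_ofReal]
  | succ n ih =>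
    simpa only [smul_eq_mul, pow_succ'] using
      (hasDerivAt_integral_cexp_neg_mul_smul Real.continuous_cosh.aemeasurable
        (fun u => (Real.cosh_pos u).le) (fun w hw => ih hw) hz).1

theorem hasDerivAt_coshMoment (n : ℕ) {z : ℂ} (hz : 0 < z.re) :
    HasDerivAt (coshMoment n) (-coshMoment (n + 1) z) z := by
  have h := (hasDerivAt_integral_cexp_neg_mul_smul (μ := volume.restrict (Set.Ioi 0))
    Real.continuous_cosh.aemeasurable (fun u => (Real.cosh_pos u).le)
    (fun w hw => (integrable_cexp_neg_mul_cosh_mul_pow n hw).integrableOn) hz).2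
  simp only [smul_eq_mul, ← pow_succ'] at h
  exact h

theorem tendsto_sinh_mul_cexp_neg_mul_cosh {z : ℂ} (hz : 0 < z.re) :
    Tendsto (fun u : ℝ => (Real.sinh u : ℂ) * Complex.exp (-z * Real.cosh u)) atTop (𝓝 0) := by
  have hcosh : Tendsto Real.cosh atTop atTop :=
    tendsto_atTop_mono (fun u => (Real.sinh_lt_cosh u).le) Real.sinhOrderIso.tendsto_atTop
  have hexp : Tendsto (fun u => 2 / z.re * rexp (-(z.re / 2) * Real.cosh u)) atTop (𝓝 0) := by
    simpa only [mul_zero, neg_mul, Function.comp_def] using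
      (Real.tendsto_exp_neg_atTop_nhds_zero.comp
        (hcosh.const_mul_atTop (half_pos hz))).const_mul (2 / z.re)
  refine squeeze_zero_norm (fun u => ?_) hexp
  calc ‖(Real.sinh u : ℂ) * Complex.exp (-z * Real.cosh u)‖
      = |Real.sinh u| * rexp (-z.re * Real.cosh u) := by
        rw [norm_mul, norm_cexp_neg_mul_ofReal, Complex.norm_real, Real.norm_eq_abs]
    _ ≤ Real.cosh u * rexp (-z.re * Real.cosh u) := by
        gcongr
        rw [Real.abs_sinh, ← Real.cosh_abs]
        exact (Real.sinh_lt_cosh _).le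
    _ ≤ _ := mul_exp_neg_mul_le hz _

theorem mul_coshMoment_two {z : ℂ} (hz : 0 < z.re) :
    z * coshMoment 2 z = coshMoment 1 z + z * coshMoment 0 z := by
  let f (n : ℕ) (u : ℝ) : ℂ := Complex.exp (-z * Real.cosh u) * (Real.cosh u : ℂ) ^ n
  have hf (n : ℕ) : IntegrableOn (f n) (Set.Ioi 0) :=
    (integrable_cexp_neg_mul_cosh_mul_pow n hz).integrableOn
  have hf₁₀ : IntegrableOn (fun u => f 1 u + z * f 0 u) (Set.Ioi 0) :=
    (hf 1).add ((hf 0).const_mul z)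
  have hderiv (u : ℝ) : HasDerivAt (fun u : ℝ => (Real.sinh u : ℂ) * Complex.exp (-z * Real.cosh u))
      (f 1 u + z * f 0 u - z * f 2 u) u := by
    have hsq : (Real.cosh u : ℂ) ^ 2 = (Real.sinh u : ℂ) ^ 2 + 1 := by
      exact_mod_cast Real.cosh_sq u
    refine ((Real.hasDerivAt_sinh u).ofReal_comp.mul
      ((Real.hasDerivAt_cosh u).ofReal_comp.const_mul (-z)).cexp).congr_deriv ?_
    linear_combination z * Complex.exp (-z * Real.cosh u) * hsq
  have h := integral_Ioi_of_hasDerivAt_of_tendsto' (a := 0) (fun u _ => hderiv u)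
    (hf₁₀.sub ((hf 2).const_mul z)) (tendsto_sinh_mul_cexp_neg_mul_cosh hz)
  rw [integral_sub hf₁₀ ((hf 2).const_mul z), integral_add (hf 1) ((hf 0).const_mul z),
    integral_const_mul, integral_const_mul, Real.sinh_zero, Complex.ofReal_zero, zero_mul,
    sub_zero] at h
  exact (sub_eq_zero.1 h).symm

theorem coshMoment_zero_ofReal (r : ℝ) :
    coshMoment 0 r = ((∫ u in Set.Ioi (0 : ℝ), rexp (-r * Real.cosh u) : ℝ) : ℂ) := by
  rw [coshMoment, ← integral_complex_ofReal]
  simp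

theorem hasDerivAt_besselK_zero {z : ℂ} (hz : 0 < z.re) :
    HasDerivAt (besselK 0) (-besselK 1 z) z := by
  rw [besselK_zero_eq_coshMoment, besselK_one_eq_coshMoment]
  exact hasDerivAt_coshMoment 0 hz

theorem hasDerivAt_neg_mul_besselK_one {z : ℂ} (hz : 0 < z.re) :
    HasDerivAt (fun z => -(z * besselK 1 z)) (z * besselK 0 z) z := by
  rw [besselK_zero_eq_coshMoment, besselK_one_eq_coshMoment]
  refine ((hasDerivAt_id z).mul (hasDerivAt_coshMoment 1 hz)).neg.congr_deriv ?_
  simp only [id]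
  linear_combination mul_coshMoment_two hz

end CoshMoment

section LogarithmicAsymptotics

theorem integral_log_mul_exp_neg :
    ∫ v in Set.Ioi (0 : ℝ), Real.log v * rexp (-v) = -Real.eulerMascheroniConstant := by
  have hone : 0 < (1 : ℂ).re := by simp
  have hGamma : HasDerivAt Complex.Gamma
      (∫ v : ℝ in Set.Ioi 0, (v : ℂ) ^ ((1 : ℂ) - 1) * (Real.log v * rexp (-v))) 1 := by
    refine (Complex.hasDerivAt_GammaIntegral hone).congr_of_eventuallyEq ?_
    filter_upwards [isOpen_setOf_re_pos.mem_nhds hone] with s hs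
    exact Complex.Gamma_eq_integral hs
  have h := hGamma.unique Complex.hasDerivAt_Gamma_one
  simp only [sub_self, Complex.cpow_zero, one_mul, ← Complex.ofReal_mul] at h
  rw [integral_complex_ofReal] at h
  exact_mod_cast h

theorem integrableOn_log_mul_exp_neg :
    IntegrableOn (fun v => Real.log v * rexp (-v)) (Set.Ioi (0 : ℝ)) := by
  by_contra h
  have hzero := integral_log_mul_exp_neg
  rw [integral_undef h] at hzero
  linarith [Real.one_half_lt_eulerMascheroniConstant]

theorem intervalIntegrable_log_mul_exp_neg (a b : ℝ) :
    IntervalIntegrable (fun v => Real.log v * rexp (-v)) volume a b :=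
  intervalIntegral.intervalIntegrable_log'.mul_continuousOn (by fun_prop)

theorem tendsto_log_mul_exp_neg_atTop :
    Tendsto (fun v : ℝ => Real.log v * rexp (-v)) atTop (𝓝 0) := by
  have h := Real.tendsto_pow_mul_exp_neg_atTop_nhds_zero 1
  refine squeeze_zero' ?_ ?_ h
  · filter_upwards [eventually_ge_atTop 1] with v hv
    exact mul_nonneg (Real.log_nonneg hv) (Real.exp_pos _).le
  · filter_upwards [eventually_ge_atTop 1] with v hv
    rw [pow_one]
    gcongr
    linarith [Real.log_le_sub_one_of_pos (one_pos.trans_le hv)]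

/-- The antiderivative of `e^{-v} / v` on `v > 0` obtained by integrating by parts, so that the
singularity at `0` is carried by the first summand alone. -/
noncomputable def expNegDivPrimitive (y : ℝ) : ℝ :=
  Real.log y * rexp (-y) + ∫ v in (0 : ℝ)..y, Real.log v * rexp (-v)

theorem hasDerivAt_expNegDivPrimitive {y : ℝ} (hy : 0 < y) :
    HasDerivAt expNegDivPrimitive (rexp (-y) / y) y := by
  have hcont : ContinuousAt (fun v => Real.log v * rexp (-v)) y :=
    (Real.continuousAt_log hy.ne').mul (by fun_prop)
  refine (((Real.hasDerivAt_log hy.ne').mul (hasDerivAt_neg y).exp).add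
    (intervalIntegral.integral_hasDerivAt_right (intervalIntegrable_log_mul_exp_neg 0 y)
      (Measurable.stronglyMeasurable (by fun_prop)).stronglyMeasurableAtFilter
      hcont)).congr_deriv ?_
  ring

theorem tendsto_expNegDivPrimitive_atTop :
    Tendsto expNegDivPrimitive atTop (𝓝 (-Real.eulerMascheroniConstant)) := by
  rw [← integral_log_mul_exp_neg, ← zero_add (∫ v in Set.Ioi (0 : ℝ), Real.log v * rexp (-v))]
  exact tendsto_log_mul_exp_neg_atTop.add
    (intervalIntegral_tendsto_integral_Ioi 0 integrableOn_log_mul_exp_neg tendsto_id)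

theorem tendsto_log_mul_one_sub_exp_neg :
    Tendsto (fun y : ℝ => Real.log y * (1 - rexp (-y))) (𝓝[>] 0) (𝓝 0) := by
  have h := (tendsto_log_mul_rpow_nhdsGT_zero one_pos).norm
  rw [norm_zero] at h
  refine squeeze_zero_norm' ?_ h
  filter_upwards [self_mem_nhdsWithin] with y (hy : 0 < y)
  have hle : rexp (-y) ≤ 1 := Real.exp_le_one_iff.2 (neg_nonpos.2 hy.le)
  rw [norm_mul, norm_mul, Real.rpow_one, Real.norm_of_nonneg hy.le,
    Real.norm_of_nonneg (sub_nonneg.2 hle)]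
  gcongr
  linarith [Real.one_sub_le_exp_neg y]

theorem tendsto_log_sub_expNegDivPrimitive :
    Tendsto (fun y => Real.log y - expNegDivPrimitive y) (𝓝[>] 0) (𝓝 0) := by
  have hcont := intervalIntegral.continuous_primitive intervalIntegrable_log_mul_exp_neg 0
  have hint := (hcont.tendsto' 0 0 intervalIntegral.integral_same).mono_left
    (nhdsWithin_le_nhds (s := Set.Ioi 0))
  refine (sub_zero (0 : ℝ) ▸ tendsto_log_mul_one_sub_exp_neg.sub hint).congr fun y => ?_
  rw [expNegDivPrimitive]
  ring

theorem integral_exp_neg_mul_exp {y : ℝ} (hy : 0 < y) :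
    IntegrableOn (fun u => rexp (-(y * rexp u))) (Set.Ioi 0) ∧
      ∫ u in Set.Ioi (0 : ℝ), rexp (-(y * rexp u)) =
        -Real.eulerMascheroniConstant - expNegDivPrimitive y := by
  have hderiv : ∀ u ∈ Set.Ici (0 : ℝ),
      HasDerivAt (fun u => expNegDivPrimitive (y * rexp u)) (rexp (-(y * rexp u))) u := by
    intro u _
    have hpos : 0 < y * rexp u := by positivity
    refine ((hasDerivAt_expNegDivPrimitive hpos).comp u
      ((Real.hasDerivAt_exp u).const_mul y)).congr_deriv ?_
    field_simp
  have hnonneg : ∀ u ∈ Set.Ioi (0 : ℝ), 0 ≤ rexp (-(y * rexp u)) := fun u _ => (Real.exp_pos _).le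
  have hlim := tendsto_expNegDivPrimitive_atTop.comp (Real.tendsto_exp_atTop.const_mul_atTop hy)
  refine ⟨integrableOn_Ioi_deriv_of_nonneg' hderiv hnonneg hlim, ?_⟩
  rw [integral_Ioi_of_hasDerivAt_of_nonneg' hderiv hnonneg hlim, Real.exp_zero, mul_one]

theorem norm_exp_neg_mul_cosh_sub_le {r : ℝ} (hr : 0 ≤ r) (u : ℝ) :
    ‖rexp (-r * Real.cosh u) - rexp (-(r / 2 * rexp u))‖ ≤ r / 2 * rexp (-u) := by
  have hsplit : rexp (-r * Real.cosh u) =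
      rexp (-(r / 2 * rexp u)) * rexp (-(r / 2 * rexp (-u))) := by
    rw [← Real.exp_add, Real.cosh_eq]; ring_nf
  have hle : rexp (-(r / 2 * rexp u)) ≤ 1 := Real.exp_le_one_iff.2 (neg_nonpos.2 (by positivity))
  have hle' : rexp (-(r / 2 * rexp (-u))) ≤ 1 :=
    Real.exp_le_one_iff.2 (neg_nonpos.2 (by positivity))
  calc ‖rexp (-r * Real.cosh u) - rexp (-(r / 2 * rexp u))‖
      = rexp (-(r / 2 * rexp u)) * (1 - rexp (-(r / 2 * rexp (-u)))) := by
        rw [hsplit, ← mul_sub_one, norm_mul, Real.norm_of_nonneg (Real.exp_pos _).le,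
          norm_sub_rev, Real.norm_of_nonneg (sub_nonneg.2 hle')]
    _ ≤ 1 * (1 - rexp (-(r / 2 * rexp (-u)))) := by gcongr
    _ ≤ _ := by linarith [Real.one_sub_le_exp_neg (r / 2 * rexp (-u))]

theorem norm_integral_exp_neg_mul_cosh_sub_le {r : ℝ} (hr : 0 < r) :
    ‖(∫ u in Set.Ioi (0 : ℝ), rexp (-r * Real.cosh u)) -
      ∫ u in Set.Ioi (0 : ℝ), rexp (-(r / 2 * rexp u))‖ ≤ r / 2 := by
  have hexp : IntegrableOn (fun u => rexp (-u)) (Set.Ioi (0 : ℝ)) := by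
    simpa only [neg_one_mul] using exp_neg_integrableOn_Ioi 0 one_pos
  rw [← integral_sub (integrable_exp_neg_mul_cosh hr).integrableOn
    (integral_exp_neg_mul_exp (half_pos hr)).1]
  calc _ ≤ ∫ u in Set.Ioi (0 : ℝ), r / 2 * rexp (-u) :=
        norm_integral_le_of_norm_le (hexp.const_mul _)
          (ae_of_all _ (norm_exp_neg_mul_cosh_sub_le hr.le))
    _ = r / 2 := by rw [integral_const_mul, integral_exp_neg_Ioi_zero, mul_one]

theorem tendsto_div_two_nhdsGT_zero : Tendsto (fun r : ℝ => r / 2) (𝓝[>] 0) (𝓝[>] 0) := by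
  refine tendsto_nhdsWithin_iff.2 ⟨?_, ?_⟩
  · exact ((continuous_id.div_const 2).tendsto' 0 0 (zero_div 2)).mono_left nhdsWithin_le_nhds
  · filter_upwards [self_mem_nhdsWithin] with r hr
    exact half_pos (Set.mem_Ioi.1 hr)

theorem tendsto_integral_exp_neg_mul_cosh_add_log :
    Tendsto (fun r : ℝ => (∫ u in Set.Ioi (0 : ℝ), rexp (-r * Real.cosh u)) + Real.log (r / 2))
      (𝓝[>] 0) (𝓝 (-Real.eulerMascheroniConstant)) := by
  have hdiff : Tendsto (fun r : ℝ => (∫ u in Set.Ioi (0 : ℝ), rexp (-r * Real.cosh u)) -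
      ∫ u in Set.Ioi (0 : ℝ), rexp (-(r / 2 * rexp u))) (𝓝[>] 0) (𝓝 0) := by
    refine squeeze_zero_norm' (a := fun r => r / 2) ?_
      (tendsto_div_two_nhdsGT_zero.mono_right nhdsWithin_le_nhds)
    filter_upwards [self_mem_nhdsWithin] with r hr
    exact norm_integral_exp_neg_mul_cosh_sub_le hr
  have hlim := (hdiff.add (tendsto_log_sub_expNegDivPrimitive.comp
    tendsto_div_two_nhdsGT_zero)).sub_const Real.eulerMascheroniConstant
  rw [zero_add, zero_sub] at hlim
  refine hlim.congr' ?_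
  filter_upwards [self_mem_nhdsWithin] with r hr
  rw [Function.comp, (integral_exp_neg_mul_exp (half_pos hr)).2]
  ring

theorem tendsto_besselK_zero_add_log :
    Tendsto (fun r : ℝ => besselK 0 r + Complex.log ((r : ℂ) / 2)) (𝓝[>] 0)
      (𝓝 (-(Real.eulerMascheroniConstant : ℂ))) := by
  rw [← Complex.ofReal_neg]
  refine ((Complex.continuous_ofReal.tendsto _).comp
    tendsto_integral_exp_neg_mul_cosh_add_log).congr' ?_
  filter_upwards [self_mem_nhdsWithin] with r (hr : 0 < r)
  rw [Function.comp, besselK_zero_eq_coshMoment, coshMoment_zero_ofReal, Complex.ofReal_add,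
    Complex.ofReal_log (half_pos hr).le, Complex.ofReal_div, Complex.ofReal_ofNat]

end LogarithmicAsymptotics

section ExponentialGeneratingFunction

variable {c d : ℕ → ℂ} {M N : ℝ}

/-- The exponential generating function `∑ c_k x^k / k!`. The Bessel series are of this form, with
`x = ± z² / 4`. -/
noncomputable def egf (c : ℕ → ℂ) (x : ℂ) : ℂ := ∑' k : ℕ, c k * (x ^ k / k.factorial)

theorem norm_mul_pow_div_factorial_le {a x : ℂ} {R : ℝ} (ha : ‖a‖ ≤ M) (hx : ‖x‖ ≤ R) (k : ℕ) :
    ‖a * (x ^ k / k.factorial)‖ ≤ M * (R ^ k / k.factorial) := by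
  rw [norm_mul, norm_div, norm_pow, Complex.norm_natCast]
  have hM : 0 ≤ M := (norm_nonneg a).trans ha
  gcongr

theorem summable_egf (hc : ∀ k, ‖c k‖ ≤ M) (x : ℂ) :
    Summable fun k : ℕ => c k * (x ^ k / k.factorial) :=
  .of_norm_bounded ((Real.summable_pow_div_factorial ‖x‖).mul_left M) fun k =>
    norm_mul_pow_div_factorial_le (hc k) le_rfl k

theorem egf_zero (c : ℕ → ℂ) : egf c 0 = c 0 := by
  rw [egf, tsum_eq_single 0 fun k hk => by simp [hk]]
  simp

theorem egf_add (hc : ∀ k, ‖c k‖ ≤ M) (hd : ∀ k, ‖d k‖ ≤ N) (x : ℂ) :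
    egf (fun k => c k + d k) x = egf c x + egf d x := by
  simp only [egf, add_mul]
  exact (summable_egf hc x).tsum_add (summable_egf hd x)

theorem egf_eq_add_tsum (hc : ∀ k, ‖c k‖ ≤ M) (x : ℂ) :
    egf c x = c 0 + ∑' k : ℕ, c (k + 1) * (x ^ (k + 1) / (k + 1).factorial) := by
  rw [egf, (summable_egf hc x).tsum_eq_zero_add]
  simp

theorem mul_pow_succ_div_factorial (a x : ℂ) (k : ℕ) :
    a * (x ^ (k + 1) / (k + 1).factorial) = x * (a / (k + 1) * (x ^ k / k.factorial)) := by
  have hk : (k : ℂ) + 1 ≠ 0 := by exact_mod_cast k.succ_ne_zero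
  have hfact : (k.factorial : ℂ) ≠ 0 := by exact_mod_cast k.factorial_ne_zero
  rw [Nat.factorial_succ]
  push_cast
  field_simp
  ring

theorem egf_eq_add_mul_egf (hc : ∀ k, ‖c k‖ ≤ M) (x : ℂ) :
    egf c x = c 0 + x * egf (fun k => c (k + 1) / (k + 1)) x := by
  rw [egf_eq_add_tsum hc, egf, ← tsum_mul_left]
  simp only [mul_pow_succ_div_factorial]

theorem norm_succ_div_succ_le (hc : ∀ k, ‖c k‖ ≤ M) (k : ℕ) : ‖c (k + 1) / (k + 1)‖ ≤ M := by
  rw [norm_div, ← Nat.cast_succ, Complex.norm_natCast]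
  exact (div_le_self (norm_nonneg _) (by exact_mod_cast k.succ_pos)).trans (hc _)

theorem hasDerivAt_egf (hc : ∀ k, ‖c k‖ ≤ M) (x : ℂ) :
    HasDerivAt (egf c) (egf (fun k => c (k + 1)) x) x := by
  have hterm (k : ℕ) (y : ℂ) : HasDerivAt (fun y => c (k + 1) * (y ^ (k + 1) / (k + 1).factorial))
      (c (k + 1) * (y ^ k / k.factorial)) y := by
    refine (((hasDerivAt_pow (k + 1) y).div_const _).const_mul _).congr_deriv ?_
    have hk : (k : ℂ) + 1 ≠ 0 := by exact_mod_cast k.succ_ne_zero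
    rw [Nat.factorial_succ]
    push_cast
    field_simp
  rw [funext (egf_eq_add_tsum hc)]
  refine HasDerivAt.const_add _ ?_
  refine hasDerivAt_tsum_of_isPreconnected (t := Metric.ball 0 (‖x‖ + 1)) (y₀ := x)
    (g := fun (k : ℕ) (y : ℂ) => c (k + 1) * (y ^ (k + 1) / (k + 1).factorial))
    (g' := fun (k : ℕ) (y : ℂ) => c (k + 1) * (y ^ k / k.factorial))
    (u := fun k => M * ((‖x‖ + 1) ^ k / k.factorial))
    ((Real.summable_pow_div_factorial (‖x‖ + 1)).mul_left M) Metric.isOpen_ball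
    (Metric.isPreconnected_ball) (fun k y _ => hterm k y) (fun k y hy => ?_) (by simp) ?_ (by simp)
  · exact norm_mul_pow_div_factorial_le (hc _) (mem_ball_zero_iff.1 hy).le k
  · exact (summable_nat_add_iff 1).2 (summable_egf hc x)

theorem continuous_egf (hc : ∀ k, ‖c k‖ ≤ M) : Continuous (egf c) :=
  continuous_iff_continuousAt.2 fun x => (hasDerivAt_egf hc x).continuousAt

theorem mul_egf_succ_succ (hc : ∀ k, ‖c k‖ ≤ M) (x : ℂ) :
    x * egf (fun k => c (k + 2)) x + egf (fun k => c (k + 1)) x =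
      egf (fun k => (k + 1) * c (k + 1)) x := by
  have hshift (k : ℕ) : x * (c (k + 2) * (x ^ k / k.factorial)) =
      ((k + 1 : ℕ) : ℂ) * c (k + 1 + 1) * (x ^ (k + 1) / (k + 1).factorial) := by
    have hk : ((k + 1 : ℕ) : ℂ) ≠ 0 := by exact_mod_cast k.succ_ne_zero
    rw [mul_pow_succ_div_factorial]
    push_cast at hk ⊢
    field_simp
  have hsum : Summable fun k : ℕ => (k : ℂ) * c (k + 1) * (x ^ k / k.factorial) := by
    rw [← summable_nat_add_iff 1]
    simp only [← hshift]
    exact (summable_egf (fun k => hc (k + 2)) x).mul_left x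
  simp only [egf, add_mul, one_mul]
  rw [hsum.tsum_add (summable_egf (fun k => hc (k + 1)) x), hsum.tsum_eq_zero_add, ← tsum_mul_left]
  simp only [hshift, Nat.cast_zero, zero_mul, zero_add]

end ExponentialGeneratingFunction

section Coefficients

/-- The coefficients `1 / k!` of the series of `I_0`, as an exponential generating function. -/
noncomputable def invFact (k : ℕ) : ℂ := 1 / k.factorial

/-- The coefficients `ψ(k + 1) / k!` of the regular part of `K_0`, as an exponential generating
function. -/
noncomputable def digammaCoeff (k : ℕ) : ℂ := Complex.digamma (k + 1) / k.factorial

theorem norm_invFact_le (k : ℕ) : ‖invFact k‖ ≤ 1 := by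
  rw [invFact, norm_div, norm_one, Complex.norm_natCast]
  exact div_le_one_of_le₀ (by exact_mod_cast k.factorial_pos) (by positivity)

theorem digamma_natCast_add_two (k : ℕ) :
    Complex.digamma (k + 1 + 1) = Complex.digamma (k + 1) + ((k : ℂ) + 1)⁻¹ := by
  refine Complex.digamma_apply_add_one _ fun n h => ?_
  have hsum : (k : ℂ) + 1 + n = 0 := by rw [h]; ring
  norm_cast at hsum
  lia

theorem norm_digamma_natCast_add_one_le (k : ℕ) :
    ‖Complex.digamma (k + 1)‖ ≤ ‖Complex.digamma 1‖ + k := by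
  induction k with
  | zero => simp
  | succ k ih =>
    have hinv : ‖((k : ℂ) + 1)⁻¹‖ ≤ 1 := by
      rw [norm_inv, ← Nat.cast_succ, Complex.norm_natCast]
      exact inv_le_one_of_one_le₀ (by exact_mod_cast k.succ_pos)
    push_cast
    rw [digamma_natCast_add_two]
    linarith [norm_add_le (Complex.digamma (k + 1)) ((k : ℂ) + 1)⁻¹]

theorem norm_digammaCoeff_le (k : ℕ) : ‖digammaCoeff k‖ ≤ ‖Complex.digamma 1‖ + 1 := by
  have hself : (k : ℝ) ≤ k.factorial := by exact_mod_cast k.self_le_factorial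
  have hone : (1 : ℝ) ≤ k.factorial := by exact_mod_cast k.factorial_pos
  rw [digammaCoeff, norm_div, Complex.norm_natCast, div_le_iff₀ (by positivity)]
  calc ‖Complex.digamma (k + 1)‖ ≤ ‖Complex.digamma 1‖ * 1 + k := by
        rw [mul_one]
        exact norm_digamma_natCast_add_one_le k
    _ ≤ ‖Complex.digamma 1‖ * k.factorial + k.factorial := by gcongr
    _ = _ := by ring

theorem succ_mul_invFact_succ (k : ℕ) : ((k : ℂ) + 1) * invFact (k + 1) = invFact k := by
  have hk : (k : ℂ) + 1 ≠ 0 := by exact_mod_cast k.succ_ne_zero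
  rw [invFact, invFact, Nat.factorial_succ]
  push_cast
  field_simp

theorem succ_mul_digammaCoeff_succ (k : ℕ) :
    ((k : ℂ) + 1) * digammaCoeff (k + 1) = digammaCoeff k + invFact (k + 1) := by
  have hk : (k : ℂ) + 1 ≠ 0 := by exact_mod_cast k.succ_ne_zero
  rw [invFact, digammaCoeff, digammaCoeff, Nat.factorial_succ]
  push_cast
  rw [digamma_natCast_add_two]
  field_simp

theorem mul_egf_invFact_succ_succ (x : ℂ) :
    x * egf (fun k => invFact (k + 2)) x + egf (fun k => invFact (k + 1)) x = egf invFact x := by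
  simp only [mul_egf_succ_succ norm_invFact_le, succ_mul_invFact_succ]

theorem mul_egf_digammaCoeff_succ_succ (x : ℂ) :
    x * egf (fun k => digammaCoeff (k + 2)) x + egf (fun k => digammaCoeff (k + 1)) x =
      egf digammaCoeff x + egf (fun k => invFact (k + 1)) x := by
  simp only [mul_egf_succ_succ norm_digammaCoeff_le, succ_mul_digammaCoeff_succ]
  exact egf_add norm_digammaCoeff_le (fun k => norm_invFact_le (k + 1)) x

end Coefficients

section ModifiedBesselEquation

variable {U V : Set ℂ} {f g f₁ g₁ f₂ g₂ : ℂ → ℂ}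

/-- The modified Bessel equation of order zero, `z (z f')' = z² f`, as a first-order system for `f`
and `g = z f'`. -/
structure IsModifiedBesselPair (U : Set ℂ) (f g : ℂ → ℂ) : Prop where
  hasDerivAt_fst : ∀ z ∈ U, HasDerivAt f (g z / z) z
  hasDerivAt_snd : ∀ z ∈ U, HasDerivAt g (z * f z) z

theorem IsModifiedBesselPair.mono (h : IsModifiedBesselPair V f g) (hUV : U ⊆ V) :
    IsModifiedBesselPair U f g :=
  ⟨fun z hz => h.hasDerivAt_fst z (hUV hz), fun z hz => h.hasDerivAt_snd z (hUV hz)⟩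

theorem IsModifiedBesselPair.sub (h₁ : IsModifiedBesselPair U f₁ g₁)
    (h₂ : IsModifiedBesselPair U f₂ g₂) : IsModifiedBesselPair U (f₁ - f₂) (g₁ - g₂) where
  hasDerivAt_fst z hz := ((h₁.hasDerivAt_fst z hz).sub (h₂.hasDerivAt_fst z hz)).congr_deriv (by
    rw [Pi.sub_apply, sub_div])
  hasDerivAt_snd z hz := ((h₁.hasDerivAt_snd z hz).sub (h₂.hasDerivAt_snd z hz)).congr_deriv (by
    rw [Pi.sub_apply, mul_sub])

theorem IsModifiedBesselPair.exists_wronskian_eq (h₁ : IsModifiedBesselPair U f₁ g₁)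
    (h₂ : IsModifiedBesselPair U f₂ g₂) (hU : IsOpen U) (hU' : IsPreconnected U) :
    ∃ c, ∀ z ∈ U, f₁ z * g₂ z - g₁ z * f₂ z = c := by
  have hderiv (z : ℂ) (hz : z ∈ U) : HasDerivAt (fun z => f₁ z * g₂ z - g₁ z * f₂ z) 0 z := by
    refine (((h₁.hasDerivAt_fst z hz).mul (h₂.hasDerivAt_snd z hz)).sub
      ((h₁.hasDerivAt_snd z hz).mul (h₂.hasDerivAt_fst z hz))).congr_deriv ?_
    ring
  exact hU.exists_is_const_of_deriv_eq_zero hU'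
    (fun z hz => (hderiv z hz).differentiableAt.differentiableWithinAt)
    fun z hz => (hderiv z hz).deriv

theorem isModifiedBesselPair_besselK_zero :
    IsModifiedBesselPair {z | 0 < z.re} (besselK 0) (fun z => -(z * besselK 1 z)) where
  hasDerivAt_fst z hz := (hasDerivAt_besselK_zero hz).congr_deriv (by
    rw [neg_div, mul_div_cancel_left₀ _ (Complex.ne_zero_of_re_pos hz)])
  hasDerivAt_snd _ hz := hasDerivAt_neg_mul_besselK_one hz

end ModifiedBesselEquation

section SeriesSolutions

/-- The power series of the modified Bessel function `I_0(z)`. -/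
noncomputable def seriesI0 (z : ℂ) : ℂ := egf invFact (z ^ 2 / 4)

/-- The power series of `z I_0'(z)`. -/
noncomputable def eulerI0 (z : ℂ) : ℂ := z ^ 2 / 2 * egf (fun k => invFact (k + 1)) (z ^ 2 / 4)

/-- The logarithmic expansion of `K_0(z)` at the origin, which continues `K_0` from the right half
plane to the plane cut along the negative real axis. -/
noncomputable def seriesK0 (z : ℂ) : ℂ :=
  -Complex.log (z / 2) * seriesI0 z + egf digammaCoeff (z ^ 2 / 4)

/-- The expansion of `z K_0'(z)` at the origin. -/
noncomputable def eulerK0 (z : ℂ) : ℂ :=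
  -seriesI0 z - Complex.log (z / 2) * eulerI0 z +
    z ^ 2 / 2 * egf (fun k => digammaCoeff (k + 1)) (z ^ 2 / 4)

/-- The continuation of `K_1 = -K_0'` to the plane cut along the negative real axis. -/
noncomputable def seriesK1 (z : ℂ) : ℂ := -(eulerK0 z / z)

variable {c : ℕ → ℂ} {M : ℝ} {z : ℂ}

theorem hasDerivAt_egf_sq_div_four (hc : ∀ k, ‖c k‖ ≤ M) (z : ℂ) :
    HasDerivAt (fun z => egf c (z ^ 2 / 4)) (z / 2 * egf (fun k => c (k + 1)) (z ^ 2 / 4)) z := by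
  refine ((hasDerivAt_egf hc (z ^ 2 / 4)).comp z ((hasDerivAt_pow 2 z).div_const 4)).congr_deriv ?_
  push_cast
  ring

theorem hasDerivAt_sq_div_two_mul_egf_succ (hc : ∀ k, ‖c k‖ ≤ M) (z : ℂ) :
    HasDerivAt (fun z => z ^ 2 / 2 * egf (fun k => c (k + 1)) (z ^ 2 / 4))
      (z * (z ^ 2 / 4 * egf (fun k => c (k + 2)) (z ^ 2 / 4) +
        egf (fun k => c (k + 1)) (z ^ 2 / 4))) z := by
  refine (((hasDerivAt_pow 2 z).div_const 2).mul
    (hasDerivAt_egf_sq_div_four (fun k => hc (k + 1)) z)).congr_deriv ?_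
  push_cast
  ring

theorem hasDerivAt_log_div_two (hz : z ∈ Complex.slitPlane) :
    HasDerivAt (fun z => Complex.log (z / 2)) (1 / z) z := by
  have hz2 : z / 2 ∈ Complex.slitPlane := by
    simpa [Complex.mem_slitPlane_iff] using hz
  have hz0 := Complex.slitPlane_ne_zero hz
  refine (((hasDerivAt_id z).div_const 2).clog hz2).congr_deriv ?_
  simp only [id]
  field_simp

theorem isModifiedBesselPair_seriesI0 : IsModifiedBesselPair {0}ᶜ seriesI0 eulerI0 where
  hasDerivAt_fst z (hz : z ≠ 0) :=
    (hasDerivAt_egf_sq_div_four norm_invFact_le z).congr_deriv (by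
      rw [eulerI0]
      field_simp)
  hasDerivAt_snd z _ :=
    (hasDerivAt_sq_div_two_mul_egf_succ norm_invFact_le z).congr_deriv (by
      rw [mul_egf_invFact_succ_succ, seriesI0])

theorem isModifiedBesselPair_seriesK0 :
    IsModifiedBesselPair Complex.slitPlane seriesK0 eulerK0 where
  hasDerivAt_fst z hz := by
    have hz0 := Complex.slitPlane_ne_zero hz
    refine (((hasDerivAt_log_div_two hz).neg.mul
      (isModifiedBesselPair_seriesI0.hasDerivAt_fst z hz0)).add
      (hasDerivAt_egf_sq_div_four norm_digammaCoeff_le z)).congr_deriv ?_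
    rw [eulerK0, Pi.neg_apply]
    field_simp
    ring
  hasDerivAt_snd z hz := by
    have hz0 := Complex.slitPlane_ne_zero hz
    refine (((isModifiedBesselPair_seriesI0.hasDerivAt_fst z hz0).neg.sub
      ((hasDerivAt_log_div_two hz).mul
        (isModifiedBesselPair_seriesI0.hasDerivAt_snd z hz0))).add
      (hasDerivAt_sq_div_two_mul_egf_succ norm_digammaCoeff_le z)).congr_deriv ?_
    rw [mul_egf_digammaCoeff_succ_succ, seriesK0, eulerI0]
    field_simp
    ring

theorem continuousAt_seriesK1 (hz : z ∈ Complex.slitPlane) : ContinuousAt seriesK1 z :=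
  ((isModifiedBesselPair_seriesK0.hasDerivAt_snd z hz).continuousAt.div continuousAt_id
    (Complex.slitPlane_ne_zero hz)).neg

theorem continuous_egf_sq_div_four (hc : ∀ k, ‖c k‖ ≤ M) :
    Continuous fun z : ℂ => egf c (z ^ 2 / 4) :=
  (continuous_egf hc).comp (by fun_prop)

theorem tendsto_ofReal_nhdsGT_zero {f : ℂ → ℂ} (hf : Continuous f) :
    Tendsto (fun r : ℝ => f r) (𝓝[>] 0) (𝓝 (f 0)) :=
  ((hf.comp Complex.continuous_ofReal).tendsto' 0 _ (by simp)).mono_left nhdsWithin_le_nhds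

theorem tendsto_seriesI0 : Tendsto (fun r : ℝ => seriesI0 r) (𝓝[>] 0) (𝓝 1) := by
  have hI : Continuous seriesI0 := continuous_egf_sq_div_four norm_invFact_le
  have hzero : seriesI0 0 = 1 := by simp [seriesI0, egf_zero, invFact]
  exact hzero ▸ tendsto_ofReal_nhdsGT_zero hI

theorem tendsto_log_div_two_mul_ofReal :
    Tendsto (fun r : ℝ => Complex.log ((r : ℂ) / 2) * r) (𝓝[>] 0) (𝓝 0) := by
  have hlog : Tendsto (fun r : ℝ => Real.log (r / 2) * (r / 2)) (𝓝[>] 0) (𝓝 0) := by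
    simpa only [Real.rpow_one, Function.comp_def] using
      (tendsto_log_mul_rpow_nhdsGT_zero one_pos).comp tendsto_div_two_nhdsGT_zero
  have hlim := (Complex.continuous_ofReal.tendsto _).comp (hlog.const_mul 2)
  rw [mul_zero, Complex.ofReal_zero] at hlim
  refine hlim.congr' ?_
  filter_upwards [self_mem_nhdsWithin] with r (hr : 0 < r)
  rw [Function.comp, Complex.ofReal_mul, Complex.ofReal_mul, Complex.ofReal_log (half_pos hr).le]
  push_cast
  ring

theorem tendsto_seriesK0_add_log :
    Tendsto (fun r : ℝ => seriesK0 r + Complex.log ((r : ℂ) / 2)) (𝓝[>] 0)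
      (𝓝 (-(Real.eulerMascheroniConstant : ℂ))) := by
  have hregular : Tendsto (fun r : ℝ => egf digammaCoeff ((r : ℂ) ^ 2 / 4)) (𝓝[>] 0)
      (𝓝 (-(Real.eulerMascheroniConstant : ℂ))) := by
    convert tendsto_ofReal_nhdsGT_zero (continuous_egf_sq_div_four norm_digammaCoeff_le) using 2
    simp [egf_zero, digammaCoeff, Complex.digamma_one]
  have hquot : Continuous fun z : ℂ =>
      z / 4 * egf (fun k => invFact (k + 1) / (k + 1)) (z ^ 2 / 4) :=
    (continuous_id.div_const 4).mul
      (continuous_egf_sq_div_four (norm_succ_div_succ_le norm_invFact_le))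
  have hlim := hregular.sub
    (tendsto_log_div_two_mul_ofReal.mul (tendsto_ofReal_nhdsGT_zero hquot))
  rw [zero_mul, sub_zero] at hlim
  refine hlim.congr fun r => ?_
  have hone : invFact 0 = 1 := by simp [invFact]
  rw [seriesK0, seriesI0, egf_eq_add_mul_egf norm_invFact_le, hone]
  ring

theorem tendsto_norm_seriesK0_atTop :
    Tendsto (fun r : ℝ => ‖seriesK0 r‖) (𝓝[>] 0) atTop := by
  have hlog : Tendsto (fun r : ℝ => -Real.log (r / 2)) (𝓝[>] 0) atTop :=
    tendsto_neg_atBot_atTop.comp (Real.tendsto_log_nhdsGT_zero.comp tendsto_div_two_nhdsGT_zero)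
  refine tendsto_atTop_mono' _ ?_ (hlog.atTop_add tendsto_seriesK0_add_log.norm.neg)
  filter_upwards [self_mem_nhdsWithin] with r (hr : 0 < r)
  have htriangle := norm_sub_norm_le (Complex.log ((r : ℂ) / 2)) (seriesK0 r + Complex.log (r / 2))
  have hre := neg_le_of_abs_le (Complex.abs_re_le_norm (Complex.log ((r : ℂ) / 2)))
  rw [sub_add_cancel_right, norm_neg] at htriangle
  rw [Complex.log_re, ← Complex.ofReal_ofNat, ← Complex.ofReal_div,
    Complex.norm_of_nonneg (half_pos hr).le] at hre
  push_cast at hre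
  linarith

theorem setOf_re_pos_subset_slitPlane : {z : ℂ | 0 < z.re} ⊆ Complex.slitPlane :=
  fun _ hz => Complex.mem_slitPlane_iff.2 (Or.inl hz)

theorem wronskian_seriesK0_seriesI0 (hz : 0 < z.re) :
    seriesK0 z * eulerI0 z - eulerK0 z * seriesI0 z = 1 := by
  obtain ⟨w, hw⟩ := (isModifiedBesselPair_seriesK0.mono
    setOf_re_pos_subset_slitPlane).exists_wronskian_eq
    (isModifiedBesselPair_seriesI0.mono fun _ hz => Complex.ne_zero_of_re_pos hz)
    isOpen_setOf_re_pos isPreconnected_setOf_re_pos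
  -- The logarithms cancel, so the Wronskian extends continuously to the origin.
  let W (z : ℂ) : ℂ := seriesI0 z ^ 2 + egf digammaCoeff (z ^ 2 / 4) * eulerI0 z -
    z ^ 2 / 2 * egf (fun k => digammaCoeff (k + 1)) (z ^ 2 / 4) * seriesI0 z
  have hW (z : ℂ) : seriesK0 z * eulerI0 z - eulerK0 z * seriesI0 z = W z := by
    simp only [W, seriesK0, eulerK0]
    ring
  have hI : Continuous seriesI0 := continuous_egf_sq_div_four norm_invFact_le
  have hI' : Continuous fun z : ℂ => egf (fun k => invFact (k + 1)) (z ^ 2 / 4) :=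
    continuous_egf_sq_div_four fun k => norm_invFact_le (k + 1)
  have hA := continuous_egf_sq_div_four norm_digammaCoeff_le
  have hB : Continuous fun z : ℂ => egf (fun k => digammaCoeff (k + 1)) (z ^ 2 / 4) :=
    continuous_egf_sq_div_four fun k => norm_digammaCoeff_le (k + 1)
  have hcont : Continuous W := by
    simp only [W, eulerI0]
    fun_prop
  have hlim : Tendsto (fun r : ℝ => W r) (𝓝[>] 0) (𝓝 w) := by
    refine tendsto_const_nhds.congr' ?_
    filter_upwards [self_mem_nhdsWithin] with r (hr : 0 < r)
    rw [← hW, hw r (by simpa using hr)]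
  rw [hw z hz, tendsto_nhds_unique hlim (tendsto_ofReal_nhdsGT_zero hcont)]
  simp [W, seriesI0, eulerI0, egf_zero, invFact]

theorem IsModifiedBesselPair.eq_zero_of_tendsto_zero {f g : ℂ → ℂ}
    (h : IsModifiedBesselPair {z | 0 < z.re} f g)
    (h0 : Tendsto (fun r : ℝ => f r) (𝓝[>] 0) (𝓝 0)) (hz : 0 < z.re) : f z = 0 := by
  have hI : IsModifiedBesselPair {z | 0 < z.re} seriesI0 eulerI0 :=
    isModifiedBesselPair_seriesI0.mono fun _ hz => Complex.ne_zero_of_re_pos hz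
  have hK := isModifiedBesselPair_seriesK0.mono setOf_re_pos_subset_slitPlane
  obtain ⟨a, ha⟩ := h.exists_wronskian_eq hI isOpen_setOf_re_pos isPreconnected_setOf_re_pos
  obtain ⟨b, hb⟩ := h.exists_wronskian_eq hK isOpen_setOf_re_pos isPreconnected_setOf_re_pos
  have hcomb (z : ℂ) (hz : 0 < z.re) : f z = a * seriesK0 z - b * seriesI0 z := by
    linear_combination (-f z) * wronskian_seriesK0_seriesI0 hz + seriesK0 z * ha z hz -
      seriesI0 z * hb z hz
  have hlim : Tendsto (fun r : ℝ => a * seriesK0 r) (𝓝[>] 0) (𝓝 b) := by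
    have hlim := h0.add (tendsto_seriesI0.const_mul b)
    rw [zero_add, mul_one] at hlim
    refine hlim.congr' ?_
    filter_upwards [self_mem_nhdsWithin] with r (hr : 0 < r)
    rw [hcomb r (by simpa using hr), sub_add_cancel]
  have ha0 : a = 0 := by
    by_contra hne
    refine not_tendsto_nhds_of_tendsto_atTop ?_ _ hlim.norm
    simp only [norm_mul]
    exact tendsto_norm_seriesK0_atTop.const_mul_atTop (norm_pos_iff.2 hne)
  have hb0 : b = 0 := by
    simp only [ha0, zero_mul] at hlim
    exact tendsto_nhds_unique hlim tendsto_const_nhds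
  rw [hcomb z hz, ha0, hb0, zero_mul, zero_mul, sub_zero]

theorem eqOn_besselK_zero_seriesK0 : Set.EqOn (besselK 0) seriesK0 {z | 0 < z.re} := by
  intro z hz
  refine sub_eq_zero.1 ((isModifiedBesselPair_besselK_zero.sub (isModifiedBesselPair_seriesK0.mono
    setOf_re_pos_subset_slitPlane)).eq_zero_of_tendsto_zero ?_ hz)
  have hlim := tendsto_besselK_zero_add_log.sub tendsto_seriesK0_add_log
  rw [sub_self] at hlim
  exact hlim.congr fun r => add_sub_add_right_eq_sub _ _ _

theorem besselK_one_eq_seriesK1 (hz : 0 < z.re) : besselK 1 z = seriesK1 z := by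
  have hderiv := (isModifiedBesselPair_seriesK0.hasDerivAt_fst z
    (setOf_re_pos_subset_slitPlane hz)).congr_of_eventuallyEq
    (eqOn_besselK_zero_seriesK0.eventuallyEq_of_mem (isOpen_setOf_re_pos.mem_nhds hz))
  rw [seriesK1, ← (hasDerivAt_besselK_zero hz).unique hderiv, neg_neg]

end SeriesSolutions

section ConnectionFormula

theorem besselJ_eq_egf (n : ℕ) (z : ℂ) :
    besselJ n z = (z / 2) ^ n * egf (fun k => invFact (n + k)) (-(z ^ 2) / 4) := by
  rw [besselJ, egf]
  congr 1
  refine tsum_congr fun k => ?_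
  rw [invFact, div_mul_div_comm, one_mul, mul_comm]

theorem digamma_add_digamma_div_factorial (k : ℕ) (x : ℂ) :
    (Complex.digamma (k + 1) + Complex.digamma (k + 1 + 1)) *
        (x ^ k / (k.factorial * (k + 1).factorial)) =
      2 * (digammaCoeff (k + 1) * (x ^ k / k.factorial)) -
        invFact (k + 1) / (k + 1) * (x ^ k / k.factorial) := by
  have hk : (k : ℂ) + 1 ≠ 0 := by exact_mod_cast k.succ_ne_zero
  have hfact : (k.factorial : ℂ) ≠ 0 := by exact_mod_cast k.factorial_ne_zero
  have hfact' : ((k + 1).factorial : ℂ) ≠ 0 := by exact_mod_cast (k + 1).factorial_ne_zero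
  rw [digammaCoeff, invFact, Nat.cast_succ, digamma_natCast_add_two]
  field_simp
  ring

theorem besselY_one_eq_egf (z : ℂ) :
    besselY 1 z = -(1 / (π : ℂ)) * (z / 2)⁻¹ + 2 / (π : ℂ) * Complex.log (z / 2) * besselJ 1 z -
      1 / (π : ℂ) * (z / 2) * (2 * egf (fun k => digammaCoeff (k + 1)) (-(z ^ 2) / 4) -
        egf (fun k => invFact (k + 1) / (k + 1)) (-(z ^ 2) / 4)) := by
  have hdigamma := (summable_egf (fun k => norm_digammaCoeff_le (k + 1)) (-(z ^ 2) / 4)).mul_left 2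
  have hinv := summable_egf (norm_succ_div_succ_le norm_invFact_le) (-(z ^ 2) / 4)
  rw [egf, egf, ← tsum_mul_left, ← hdigamma.tsum_sub hinv]
  simp only [← digamma_add_digamma_div_factorial, besselY, pow_one, Finset.range_one,
    Finset.sum_singleton, Nat.cast_one, add_comm 1]
  simp [add_comm (1 : ℂ)]

theorem log_I_mul_div_two {y : ℝ} (hy : 0 < y) :
    Complex.log (Complex.I * y / 2) = Real.log (y / 2) + π / 2 * Complex.I := by
  have hpolar : Complex.I * (y : ℂ) / 2 = ((y / 2 : ℝ) : ℂ) * Complex.I := by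
    push_cast
    ring
  rw [hpolar, Complex.log_ofReal_mul (half_pos hy) Complex.I_ne_zero, Complex.log_I]

theorem log_neg_div_two {y : ℝ} (hy : 0 < y) :
    Complex.log (((-y : ℝ) : ℂ) / 2) = Real.log (y / 2) + π * Complex.I := by
  have hpolar : ((-y : ℝ) : ℂ) / 2 = ((y / 2 : ℝ) : ℂ) * (-1) := by
    push_cast
    ring
  rw [hpolar, Complex.log_ofReal_mul (half_pos hy) (by simp), Complex.log_neg_one]

-- Rotating from `i y` to `-y` shifts the logarithm by `i π / 2`, which turns the logarithmic term
-- of `Y_1` into the missing `J_1`.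
theorem seriesK1_I_mul {y : ℝ} (hy : 0 < y) :
    seriesK1 (Complex.I * y) = -((π : ℂ) / 2) * hankelH1 1 ((-y : ℝ) : ℂ) := by
  have hy0 : (y : ℂ) ≠ 0 := by exact_mod_cast hy.ne'
  have hpi : (π : ℂ) ≠ 0 := by exact_mod_cast Real.pi_ne_zero
  have hI : (Complex.I * y) ^ 2 / 4 = -((y : ℂ) ^ 2) / 4 := by rw [mul_pow, Complex.I_sq]; ring
  have hneg : -(((-y : ℝ) : ℂ) ^ 2) / 4 = -((y : ℂ) ^ 2) / 4 := by push_cast; ring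
  have hone : invFact 0 = 1 := by simp [invFact]
  rw [hankelH1, besselY_one_eq_egf, besselJ_eq_egf, seriesK1, eulerK0, seriesI0, eulerI0,
    egf_eq_add_mul_egf norm_invFact_le, hone, hI, hneg, log_I_mul_div_two hy, log_neg_div_two hy,
    mul_pow, Complex.I_sq]
  simp only [add_comm 1]
  generalize egf (fun k => invFact (k + 1) / (k + 1)) (-((y : ℂ) ^ 2) / 4) = D
  generalize egf (fun k => invFact (k + 1)) (-((y : ℂ) ^ 2) / 4) = A
  generalize egf (fun k => digammaCoeff (k + 1)) (-((y : ℂ) ^ 2) / 4) = B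
  push_cast
  have hI0 := Complex.I_ne_zero
  field_simp
  ring_nf
  simp only [Complex.I_sq, Complex.I_pow_three]
  ring_nf

end ConnectionFormula

section ComplexSqrt

variable {a b w z : ℂ}

theorem sqrt_sq (z : ℂ) : z.sqrt ^ 2 = z :=
  Complex.cpow_ofNat_inv_pow z 2

theorem sqrt_re_pos (hz : z ∈ Complex.slitPlane) : 0 < z.sqrt.re := by
  rw [Complex.sqrt, Complex.cpow_inv_two_re, Real.sqrt_pos]
  refine half_pos ?_
  rcases Complex.mem_slitPlane_iff.1 hz with hre | him
  · linarith [norm_nonneg z]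
  · linarith [(abs_lt.1 (Complex.abs_re_lt_norm.2 him)).1]

theorem sqrt_ofReal {r : ℝ} (hr : 0 ≤ r) : Complex.sqrt r = √r := by
  simpa using Complex.sqrt_of_nonneg (a := (r : ℂ)) (by exact_mod_cast hr)

theorem eq_of_sq_eq_sq_of_re_pos (hz : 0 < z.re) (hw : 0 < w.re) (h : z ^ 2 = w ^ 2) : z = w := by
  refine (sq_eq_sq_iff_eq_or_eq_neg.1 h).resolve_right fun hneg => ?_
  rw [hneg, Complex.neg_re] at hz
  linarith

theorem abs_im_sqrt_lt_re_sqrt (hz : 0 < z.re) : |z.sqrt.im| < z.sqrt.re := by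
  have hsq := congr_arg Complex.re (sqrt_sq z)
  rw [sq, Complex.mul_re] at hsq
  exact abs_lt_of_sq_lt_sq (by linarith)
    (sqrt_re_pos (setOf_re_pos_subset_slitPlane hz)).le

theorem re_sqrt_mul_sqrt_pos (ha : 0 < a.re) (hb : 0 < b.re) : 0 < (a.sqrt * b.sqrt).re := by
  have hmul : |a.sqrt.im * b.sqrt.im| < a.sqrt.re * b.sqrt.re := by
    rw [abs_mul]
    exact mul_lt_mul'' (abs_im_sqrt_lt_re_sqrt ha) (abs_im_sqrt_lt_re_sqrt hb) (abs_nonneg _)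
      (abs_nonneg _)
  rw [Complex.mul_re]
  linarith [le_abs_self (a.sqrt.im * b.sqrt.im)]

theorem hasDerivAt_sqrt (hz : z ∈ Complex.slitPlane) :
    HasDerivAt Complex.sqrt (1 / (2 * z.sqrt)) z := by
  refine (Complex.hasDerivAt_sqrt hz).congr_deriv ?_
  rw [neg_div, Complex.cpow_neg, Complex.sqrt, one_div (2 : ℂ), div_eq_mul_inv, ← mul_inv, one_div,
    mul_comm]

end ComplexSqrt

section BoostIntegral

variable {a b w z : ℂ}

theorem integral_eq_integral_Ioi_add_comp_neg {E : Type*} [NormedAddCommGroup E] [NormedSpace ℝ E]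
    {f : ℝ → E} (hf : Integrable f) : ∫ u, f u = ∫ u in Set.Ioi (0 : ℝ), (f u + f (-u)) := by
  rw [integral_add hf.integrableOn hf.comp_neg.integrableOn, integral_comp_neg_Ioi, neg_zero,
    add_comm, intervalIntegral.integral_Iic_add_Ioi hf.integrableOn hf.integrableOn]

/-- The integral `∫ e^{-(a e^u + b e^{-u}) / 2} du` over the real line. A boost, that is a
translation of `u`, shows that it depends on `a b` only; for `a = b` it is `2 K_0(a)`. -/
noncomputable def boostIntegral (a b : ℂ) : ℂ :=
  ∫ u : ℝ, Complex.exp (-(a * rexp u + b * rexp (-u)) / 2)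

theorem integrable_boostIntegral (ha : 0 < a.re) (hb : 0 < b.re) :
    Integrable fun u : ℝ => Complex.exp (-(a * rexp u + b * rexp (-u)) / 2) := by
  refine (integrable_exp_neg_mul_cosh (lt_min ha hb)).mono' (by fun_prop) (ae_of_all _ fun u => ?_)
  have hre : (-(a * rexp u + b * rexp (-u)) / 2).re =
      -(a.re * rexp u + b.re * rexp (-u)) / 2 := by
    rw [Complex.div_ofNat_re, Complex.neg_re, Complex.add_re, Complex.re_mul_ofReal,
      Complex.re_mul_ofReal]
  rw [Complex.norm_exp, hre, Real.exp_le_exp, Real.cosh_eq]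
  have hle : min a.re b.re * rexp u ≤ a.re * rexp u := by gcongr; exact min_le_left _ _
  have hle' : min a.re b.re * rexp (-u) ≤ b.re * rexp (-u) := by gcongr; exact min_le_right _ _
  linarith

theorem boostIntegral_comm (a b : ℂ) : boostIntegral a b = boostIntegral b a := by
  rw [boostIntegral, ← integral_neg_eq_self]
  simp only [neg_neg, add_comm, boostIntegral]

theorem differentiableOn_boostIntegral_left (hb : 0 < b.re) :
    DifferentiableOn ℂ (fun a => boostIntegral a b) {a | 0 < a.re} := by
  have hsplit (a : ℂ) (u : ℝ) : Complex.exp (-(a * rexp u + b * rexp (-u)) / 2) =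
      Complex.exp (-a * (rexp u / 2 : ℝ)) • Complex.exp (-(b * rexp (-u)) / 2) := by
    rw [smul_eq_mul, ← Complex.exp_add]
    push_cast
    ring_nf
  intro a ha
  simp only [boostIntegral, hsplit]
  refine (hasDerivAt_integral_cexp_neg_mul_smul (X := fun u => rexp u / 2) (by fun_prop)
    (fun u => by positivity) (fun z hz => ?_) ha).2.differentiableAt.differentiableWithinAt
  simpa only [hsplit] using integrable_boostIntegral hz hb

theorem boostIntegral_self (hz : 0 < z.re) : boostIntegral z z = 2 * besselK 0 z := by
  have hcosh (u : ℝ) : -(z * rexp u + z * rexp (-u)) / 2 = -z * Real.cosh u := by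
    rw [Real.cosh_eq]
    push_cast
    ring
  have hint := integrable_boostIntegral hz hz
  simp only [boostIntegral, hcosh] at hint ⊢
  rw [integral_eq_integral_Ioi_add_comp_neg hint, besselK_zero_eq_coshMoment, coshMoment,
    ← integral_const_mul]
  simp only [Real.cosh_neg, pow_zero, mul_one, two_mul]

theorem boostIntegral_sq_ofReal {α β : ℝ} (hα : 0 < α) (hβ : 0 < β) :
    boostIntegral ((α : ℂ) ^ 2) ((β : ℂ) ^ 2) = boostIntegral (α * β) (α * β) := by
  rw [boostIntegral, boostIntegral, ← integral_add_right_eq_self _ (Real.log (β / α))]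
  congr 1 with u
  have hα0 : (α : ℂ) ≠ 0 := by exact_mod_cast hα.ne'
  have hβ0 : (β : ℂ) ≠ 0 := by exact_mod_cast hβ.ne'
  rw [neg_add u, Real.exp_add, Real.exp_add, Real.exp_neg (Real.log _),
    Real.exp_log (div_pos hβ hα)]
  push_cast
  congr 3
  field_simp

theorem boostIntegral_ofReal {r s : ℝ} (hr : 0 < r) (hs : 0 < s) :
    boostIntegral r s = 2 * besselK 0 (Complex.sqrt r * Complex.sqrt s) := by
  rw [← boostIntegral_self (re_sqrt_mul_sqrt_pos (by simpa using hr) (by simpa using hs)),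
    sqrt_ofReal hr.le, sqrt_ofReal hs.le,
    ← boostIntegral_sq_ofReal (Real.sqrt_pos.2 hr) (Real.sqrt_pos.2 hs)]
  norm_cast
  rw [Real.sq_sqrt hr.le, Real.sq_sqrt hs.le]

theorem differentiableOn_besselK_zero_sqrt_mul (hb : 0 < b.re) :
    DifferentiableOn ℂ (fun a : ℂ => 2 * besselK 0 (a.sqrt * b.sqrt)) {a | 0 < a.re} := by
  intro a ha
  have hsqrt := (Complex.differentiableAt_sqrt (setOf_re_pos_subset_slitPlane ha)).mul_const b.sqrt
  have hbessel := (hasDerivAt_besselK_zero (re_sqrt_mul_sqrt_pos ha hb)).differentiableAt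
  exact ((hbessel.comp (f := fun a : ℂ => a.sqrt * b.sqrt) a hsqrt).const_mul
    2).differentiableWithinAt

theorem boostIntegral_eq_besselK_zero_sqrt_mul_sqrt (ha : 0 < a.re) (hb : 0 < b.re) :
    boostIntegral a b = 2 * besselK 0 (a.sqrt * b.sqrt) := by
  refine eqOn_re_pos_of_eq_ofReal (differentiableOn_boostIntegral_left hb)
    (differentiableOn_besselK_zero_sqrt_mul hb) (fun r hr => ?_) ha
  have hr' : 0 < (r : ℂ).re := by simpa using hr
  simp only [boostIntegral_comm (r : ℂ), mul_comm (Complex.sqrt r)]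
  exact eqOn_re_pos_of_eq_ofReal (differentiableOn_boostIntegral_left hr')
    (differentiableOn_besselK_zero_sqrt_mul hr') (fun s hs => boostIntegral_ofReal hs hr) hb

theorem boostIntegral_eq_besselK_zero (ha : 0 < a.re) (hb : 0 < b.re) (hw : 0 < w.re)
    (h : w ^ 2 = a * b) : boostIntegral a b = 2 * besselK 0 w := by
  rw [boostIntegral_eq_besselK_zero_sqrt_mul_sqrt ha hb,
    eq_of_sq_eq_sq_of_re_pos (re_sqrt_mul_sqrt_pos ha hb) hw (by rw [mul_pow, sqrt_sq, sqrt_sq, h])]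

end BoostIntegral

section FourierLaplace

variable {m : ℝ} {s : ℂ}

theorem re_ofReal_mul_add_I_mul_pos (hm : 0 < m) (hs : 0 < s.re) (x : ℝ) :
    0 < (m * (s + Complex.I * x)).re := by
  simpa using mul_pos hm hs

theorem sq_add_sq_mem_slitPlane (hs : 0 < s.re) (x : ℝ) :
    s ^ 2 + (x : ℂ) ^ 2 ∈ Complex.slitPlane := by
  have hre : (s ^ 2 + (x : ℂ) ^ 2).re = s.re ^ 2 - s.im ^ 2 + x ^ 2 := by simp [sq]
  have him : (s ^ 2 + (x : ℂ) ^ 2).im = 2 * (s.re * s.im) := by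
    simp only [sq, Complex.add_im, Complex.mul_im, Complex.ofReal_re, Complex.ofReal_im]
    ring
  rw [Complex.mem_slitPlane_iff, hre, him]
  rcases eq_or_ne s.im 0 with h0 | h0
  · left
    rw [h0, zero_pow two_ne_zero, sub_zero]
    positivity
  · exact .inr (mul_ne_zero two_ne_zero (mul_ne_zero hs.ne' h0))

theorem re_sqrt_sq_add_sq_pos (hs : 0 < s.re) (x : ℝ) : 0 < (s ^ 2 + (x : ℂ) ^ 2).sqrt.re :=
  sqrt_re_pos (sq_add_sq_mem_slitPlane hs x)

theorem hasDerivAt_sqrt_sq_add_sq (hs : 0 < s.re) (x : ℝ) :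
    HasDerivAt (fun s : ℂ => (s ^ 2 + (x : ℂ) ^ 2).sqrt) (s / (s ^ 2 + (x : ℂ) ^ 2).sqrt) s := by
  refine ((hasDerivAt_sqrt (sq_add_sq_mem_slitPlane hs x)).comp s
    ((hasDerivAt_pow 2 s).add_const _)).congr_deriv ?_
  push_cast
  field_simp

theorem cexp_boost_eq (m x : ℝ) (s : ℂ) (u : ℝ) :
    Complex.exp (-(m * (s + Complex.I * (-x : ℝ)) * rexp u +
        m * (s + Complex.I * x) * rexp (-u)) / 2) =
      Complex.exp (-s * (m * Real.cosh u : ℝ)) •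
        Complex.exp (Complex.I * (m * Real.sinh u : ℝ) * x) := by
  rw [smul_eq_mul, ← Complex.exp_add, Real.cosh_eq, Real.sinh_eq]
  push_cast
  ring_nf

theorem integrable_cexp_cosh_smul_cexp_sinh (hm : 0 < m) (hs : 0 < s.re) (x : ℝ) :
    Integrable fun u : ℝ => Complex.exp (-s * (m * Real.cosh u : ℝ)) •
      Complex.exp (Complex.I * (m * Real.sinh u : ℝ) * x) := by
  simp only [← cexp_boost_eq]
  exact integrable_boostIntegral (re_ofReal_mul_add_I_mul_pos hm hs _)
    (re_ofReal_mul_add_I_mul_pos hm hs _)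

theorem integral_cexp_cosh_smul_cexp_sinh (hm : 0 < m) (hs : 0 < s.re) (x : ℝ) :
    ∫ u : ℝ, Complex.exp (-s * (m * Real.cosh u : ℝ)) •
        Complex.exp (Complex.I * (m * Real.sinh u : ℝ) * x) =
      2 * besselK 0 (m * (s ^ 2 + (x : ℂ) ^ 2).sqrt) := by
  simp only [← cexp_boost_eq]
  refine boostIntegral_eq_besselK_zero (re_ofReal_mul_add_I_mul_pos hm hs _)
    (re_ofReal_mul_add_I_mul_pos hm hs _) ?_ ?_
  · simpa using mul_pos hm (re_sqrt_sq_add_sq_pos hs x)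
  · rw [mul_pow, sqrt_sq]
    push_cast
    linear_combination (m : ℂ) ^ 2 * (x : ℂ) ^ 2 * Complex.I_sq

theorem integral_cexp_cosh_mul_cosh_mul_cexp_sinh (hm : 0 < m) (hs : 0 < s.re) (x : ℝ) :
    Integrable (fun u : ℝ => Complex.exp (-s * (m * Real.cosh u : ℝ)) •
        ((m * Real.cosh u : ℝ) : ℂ) • Complex.exp (Complex.I * (m * Real.sinh u : ℝ) * x)) ∧
      ∫ u : ℝ, Complex.exp (-s * (m * Real.cosh u : ℝ)) •
          ((m * Real.cosh u : ℝ) : ℂ) • Complex.exp (Complex.I * (m * Real.sinh u : ℝ) * x) =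
        2 * (m * s / (s ^ 2 + (x : ℂ) ^ 2).sqrt) *
          besselK 1 (m * (s ^ 2 + (x : ℂ) ^ 2).sqrt) := by
  obtain ⟨hint, hderiv⟩ := hasDerivAt_integral_cexp_neg_mul_smul (μ := volume)
    (X := fun u : ℝ => m * Real.cosh u) (by fun_prop)
    (fun u => mul_nonneg hm.le (Real.cosh_pos u).le)
    (fun s hs => integrable_cexp_cosh_smul_cexp_sinh hm hs x) hs
  refine ⟨hint, ?_⟩
  have hre : 0 < (m * (s ^ 2 + (x : ℂ) ^ 2).sqrt).re := by
    simpa using mul_pos hm (re_sqrt_sq_add_sq_pos hs x)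
  have hbessel := ((hasDerivAt_besselK_zero hre).comp s
    ((hasDerivAt_sqrt_sq_add_sq hs x).const_mul (m : ℂ))).const_mul 2
  have hunique := hderiv.unique (hbessel.congr_of_eventuallyEq ?_)
  · linear_combination -hunique
  · filter_upwards [isOpen_setOf_re_pos.mem_nhds hs] with s hs
    exact integral_cexp_cosh_smul_cexp_sinh hm hs x

theorem sqrt_sq_add_mul_sinh_sq (hm : 0 ≤ m) (u : ℝ) :
    √(m ^ 2 + (m * Real.sinh u) ^ 2) = m * Real.cosh u := by
  have hsq : m ^ 2 + (m * Real.sinh u) ^ 2 = (m * Real.cosh u) ^ 2 := by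
    rw [mul_pow, mul_pow, Real.cosh_sq]
    ring
  rw [hsq, Real.sqrt_sq (mul_nonneg hm (Real.cosh_pos u).le)]

theorem integral_comp_mul_sinh {E : Type*} [NormedAddCommGroup E] [NormedSpace ℝ E]
    (hm : 0 < m) (f : ℝ → E) :
    (Integrable f ↔ Integrable fun u => (m * Real.cosh u) • f (m * Real.sinh u)) ∧
      ∫ p, f p = ∫ u, (m * Real.cosh u) • f (m * Real.sinh u) := by
  have himg : (fun u => m * Real.sinh u) '' Set.univ = Set.univ := by
    rw [Set.image_univ]
    exact ((mul_left_surjective₀ hm.ne').comp Real.sinh_surjective).range_eq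
  have hderiv : ∀ u ∈ (Set.univ : Set ℝ), HasDerivWithinAt (fun u => m * Real.sinh u)
      (m * Real.cosh u) Set.univ u :=
    fun u _ => ((Real.hasDerivAt_sinh u).const_mul m).hasDerivWithinAt
  have hinj : Set.InjOn (fun u => m * Real.sinh u) Set.univ :=
    ((mul_right_injective₀ hm.ne').comp Real.sinh_injective).injOn
  have habs (u : ℝ) : |m * Real.cosh u| = m * Real.cosh u :=
    abs_of_pos (mul_pos hm (Real.cosh_pos u))
  have hiff := integrableOn_image_iff_integrableOn_abs_deriv_smul .univ hderiv hinj f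
  have heq := integral_image_eq_integral_abs_deriv_smul .univ hderiv hinj f
  simp only [himg, integrableOn_univ, Measure.restrict_univ, habs] at hiff heq
  exact ⟨hiff, heq⟩

theorem integral_cexp_neg_mul_sqrt_mul_cexp (hm : 0 < m) (hs : 0 < s.re) (x : ℝ) :
    Integrable (fun p : ℝ =>
        Complex.exp (-s * √(m ^ 2 + p ^ 2)) * Complex.exp (Complex.I * p * x)) ∧
      ∫ p : ℝ, Complex.exp (-s * √(m ^ 2 + p ^ 2)) * Complex.exp (Complex.I * p * x) =
        2 * (m * s / (s ^ 2 + (x : ℂ) ^ 2).sqrt) *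
          besselK 1 (m * (s ^ 2 + (x : ℂ) ^ 2).sqrt) := by
  have hsubst (u : ℝ) : (m * Real.cosh u) • (Complex.exp (-s * √(m ^ 2 + (m * Real.sinh u) ^ 2)) *
        Complex.exp (Complex.I * (m * Real.sinh u : ℝ) * x)) =
      Complex.exp (-s * (m * Real.cosh u : ℝ)) •
        ((m * Real.cosh u : ℝ) : ℂ) • Complex.exp (Complex.I * (m * Real.sinh u : ℝ) * x) := by
    rw [sqrt_sq_add_mul_sinh_sq hm.le, Complex.real_smul, smul_eq_mul, smul_eq_mul, mul_left_comm]
  obtain ⟨hiff, heq⟩ := integral_comp_mul_sinh hm fun p : ℝ =>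
    Complex.exp (-s * √(m ^ 2 + p ^ 2)) * Complex.exp (Complex.I * p * x)
  simp only [hsubst] at hiff heq
  obtain ⟨hint, hval⟩ := integral_cexp_cosh_mul_cosh_mul_cexp_sinh hm hs x
  exact ⟨hiff.2 hint, heq.trans hval⟩

theorem integral_Ioi_cexp_neg_mul_sqrt_mul_cos (hm : 0 < m) (hs : 0 < s.re) (x : ℝ) :
    IntegrableOn (fun p : ℝ => Complex.exp (-s * √(m ^ 2 + p ^ 2)) * (Real.cos (p * x) : ℂ))
        (Set.Ioi 0) ∧
      ∫ p in Set.Ioi (0 : ℝ), Complex.exp (-s * √(m ^ 2 + p ^ 2)) * (Real.cos (p * x) : ℂ) =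
        m * s / (s ^ 2 + (x : ℂ) ^ 2).sqrt * besselK 1 (m * (s ^ 2 + (x : ℂ) ^ 2).sqrt) := by
  obtain ⟨hint, hval⟩ := integral_cexp_neg_mul_sqrt_mul_cexp hm hs x
  have heven (p : ℝ) : Complex.exp (-s * √(m ^ 2 + p ^ 2)) * Complex.exp (Complex.I * p * x) +
      Complex.exp (-s * √(m ^ 2 + (-p) ^ 2)) * Complex.exp (Complex.I * (-p : ℝ) * x) =
        2 * (Complex.exp (-s * √(m ^ 2 + p ^ 2)) * (Real.cos (p * x) : ℂ)) := by
    rw [neg_sq, Complex.ofReal_cos, Complex.cos]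
    push_cast
    ring_nf
  have hint' := hint.add hint.comp_neg
  rw [integral_eq_integral_Ioi_add_comp_neg hint] at hval
  simp only [Pi.add_def, heven] at hint' hval
  rw [integral_const_mul] at hval
  have htwo : IsUnit (2 : ℂ) := isUnit_iff_ne_zero.2 two_ne_zero
  refine ⟨((integrable_const_mul_iff htwo _).1 hint').integrableOn, ?_⟩
  linear_combination hval / 2

end FourierLaplace

section Limit

variable {m : ℝ}

theorem continuousOn_sqrt_im_nonneg : ContinuousOn Complex.sqrt {z | 0 ≤ z.im} := by
  have hsqrt : Set.EqOn Complex.sqrt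
      (fun z => (√((‖z‖ + z.re) / 2) : ℝ) + (√((‖z‖ - z.re) / 2) : ℝ) * Complex.I)
      {z | 0 ≤ z.im} := by
    intro z hz
    rw [← Complex.re_add_im z.sqrt, Complex.sqrt, Complex.cpow_inv_two_re,
      Complex.cpow_inv_two_im_eq_sqrt hz]
  exact Continuous.continuousOn (by fun_prop) |>.congr hsqrt

theorem integrand_eq_cexp_mul (m x : ℝ) (τ : ℂ) (p : ℝ) :
    integrand m x τ p = Complex.exp (Complex.I * m * τ) *
      (Complex.exp (-(Complex.I * τ) * √(m ^ 2 + p ^ 2)) * (Real.cos (p * x) : ℂ)) := by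
  rw [integrand, hamiltonian, ← mul_assoc, ← Complex.exp_add]
  push_cast
  ring_nf

theorem integrableOn_integrand (hm : 0 < m) {τ : ℂ} (hτ : τ.im < 0) (x : ℝ) :
    IntegrableOn (integrand m x τ) (Set.Ioi 0) := by
  have hre : 0 < (Complex.I * τ).re := by simpa using hτ
  rw [funext (integrand_eq_cexp_mul m x τ)]
  exact (integral_Ioi_cexp_neg_mul_sqrt_mul_cos hm hre x).1.const_mul _

theorem complexTimeIntegral_eq_besselK (hm : 0 < m) {τ : ℂ} (hτ : τ.im < 0) (x : ℝ) :
    complexTimeIntegral m x τ = Complex.I * m * τ * Complex.exp (Complex.I * m * τ) /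
      (π * ((Complex.I * τ) ^ 2 + (x : ℂ) ^ 2).sqrt) *
        besselK 1 (m * ((Complex.I * τ) ^ 2 + (x : ℂ) ^ 2).sqrt) := by
  have hre : 0 < (Complex.I * τ).re := by simpa using hτ
  rw [complexTimeIntegral, funext (integrand_eq_cexp_mul m x τ), integral_const_mul,
    (integral_Ioi_cexp_neg_mul_sqrt_mul_cos hm hre x).2]
  ring

theorem isPropagatorValue_of_tendsto_sqrt (hm : 0 < m) {x t : ℝ} {w : ℂ}
    (hw : w ∈ Complex.slitPlane)
    (hlim : Tendsto (fun ε : ℝ => ((Complex.I * (t - ε * Complex.I)) ^ 2 + (x : ℂ) ^ 2).sqrt)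
      (𝓝[>] 0) (𝓝 w)) :
    IsPropagatorValue m x t (Complex.I * m * t * Complex.exp (Complex.I * m * t) / (π * w) *
      seriesK1 (m * w)) := by
  have him {ε : ℝ} (hε : 0 < ε) : ((t : ℂ) - ε * Complex.I).im < 0 := by simpa using hε
  refine ⟨fun ε hε => integrableOn_integrand hm (him hε) x, ?_⟩
  have hmw : (m : ℂ) * w ∈ Complex.slitPlane := by
    simpa [Complex.mem_slitPlane_iff, hm, hm.ne'] using Complex.mem_slitPlane_iff.1 hw
  have hτ : Tendsto (fun ε : ℝ => (t : ℂ) - ε * Complex.I) (𝓝[>] 0) (𝓝 t) := by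
    have hcont : Continuous fun ε : ℝ => (t : ℂ) - ε * Complex.I := by fun_prop
    simpa using (hcont.tendsto 0).mono_left nhdsWithin_le_nhds
  have hden : (π : ℂ) * w ≠ 0 :=
    mul_ne_zero (by exact_mod_cast Real.pi_ne_zero) (Complex.slitPlane_ne_zero hw)
  have hseries := ((hτ.const_mul (Complex.I * m)).mul (hτ.const_mul (Complex.I * m)).cexp).div
    (hlim.const_mul (π : ℂ)) hden |>.mul
      ((continuousAt_seriesK1 hmw).tendsto.comp (hlim.const_mul (m : ℂ)))
  refine hseries.congr' ?_
  filter_upwards [self_mem_nhdsWithin] with ε hε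
  have hre : 0 < (Complex.I * ((t : ℂ) - ε * Complex.I)).re := by simpa using him hε
  rw [complexTimeIntegral_eq_besselK hm (him hε), besselK_one_eq_seriesK1]
  · rfl
  · simpa using mul_pos hm (re_sqrt_sq_add_sq_pos hre x)

theorem tendsto_I_mul_sq_add_sq (x t : ℝ) :
    Tendsto (fun ε : ℝ => (Complex.I * ((t : ℂ) - ε * Complex.I)) ^ 2 + (x : ℂ) ^ 2)
      (𝓝[>] 0) (𝓝 ((x ^ 2 - t ^ 2 : ℝ) : ℂ)) := by
  have hcont : Continuous fun ε : ℝ =>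
    (Complex.I * ((t : ℂ) - ε * Complex.I)) ^ 2 + (x : ℂ) ^ 2 := by fun_prop
  convert (hcont.tendsto 0).mono_left nhdsWithin_le_nhds using 2
  push_cast
  linear_combination -(t : ℂ) ^ 2 * Complex.I_sq

theorem tendsto_sqrt_of_sq_lt_sq {x t : ℝ} (h : t ^ 2 < x ^ 2) :
    Tendsto (fun ε : ℝ => ((Complex.I * ((t : ℂ) - ε * Complex.I)) ^ 2 + (x : ℂ) ^ 2).sqrt)
      (𝓝[>] 0) (𝓝 (√(x ^ 2 - t ^ 2) : ℝ)) := by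
  have hpos : 0 < x ^ 2 - t ^ 2 := sub_pos.2 h
  have hsqrt := Complex.continuousAt_sqrt (z := ((x ^ 2 - t ^ 2 : ℝ) : ℂ))
    (.inl hpos.le)
  rw [← sqrt_ofReal hpos.le]
  exact hsqrt.tendsto.comp (tendsto_I_mul_sq_add_sq x t)

-- The argument of the square root tends to a point of the branch cut; for `0 < t` it does so from
-- above, where the principal branch is continuous.
theorem tendsto_sqrt_of_sq_lt_sq_of_pos {x t : ℝ} (ht : 0 < t) (h : x ^ 2 < t ^ 2) :
    Tendsto (fun ε : ℝ => ((Complex.I * ((t : ℂ) - ε * Complex.I)) ^ 2 + (x : ℂ) ^ 2).sqrt)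
      (𝓝[>] 0) (𝓝 (Complex.I * √(t ^ 2 - x ^ 2))) := by
  have hpos : 0 < t ^ 2 - x ^ 2 := sub_pos.2 h
  have hval : Complex.sqrt ((x ^ 2 - t ^ 2 : ℝ) : ℂ) = Complex.I * √(t ^ 2 - x ^ 2) := by
    rw [← neg_sub, Complex.ofReal_neg, Complex.sqrt_neg_of_nonneg (by exact_mod_cast hpos.le),
      sqrt_ofReal hpos.le]
  rw [← hval]
  refine (continuousOn_sqrt_im_nonneg _ (Complex.ofReal_im _).ge).tendsto.comp
    (tendsto_nhdsWithin_iff.2 ⟨tendsto_I_mul_sq_add_sq x t, ?_⟩)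
  filter_upwards [self_mem_nhdsWithin] with ε hε
  have him : ((Complex.I * ((t : ℂ) - ε * Complex.I)) ^ 2 + (x : ℂ) ^ 2).im = 2 * ε * t := by
    simp only [sq, Complex.add_im, Complex.sub_im, Complex.sub_re, Complex.mul_im, Complex.mul_re,
      Complex.I_re, Complex.I_im, Complex.ofReal_re, Complex.ofReal_im]
    ring
  rw [him]
  exact (mul_pos (mul_pos two_pos hε) ht).le

end Limit

end Salpeter

theorem mainTheorem1 (m : ℝ) (hm : 0 < m) :
    (∀ x t : ℝ, t ^ 2 < x ^ 2 →
      Salpeter.IsPropagatorValue m x t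
        (Complex.I * (m : ℂ) * (t : ℂ) * Complex.exp (Complex.I * (m : ℂ) * (t : ℂ)) /
            ((π : ℂ) * (√(x ^ 2 - t ^ 2) : ℂ)) *
          Salpeter.besselK 1 ((m * √(x ^ 2 - t ^ 2) : ℝ) : ℂ))) ∧
    (∀ x t : ℝ, 0 < t → x ^ 2 < t ^ 2 →
      Salpeter.IsPropagatorValue m x t
        (-((m : ℂ) * (t : ℂ) * Complex.exp (Complex.I * (m : ℂ) * (t : ℂ)) /
            (2 * (√(t ^ 2 - x ^ 2) : ℂ))) *
          Salpeter.hankelH1 1 ((-m * √(t ^ 2 - x ^ 2) : ℝ) : ℂ))) := by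
  refine ⟨fun x t h => ?_, fun x t ht h => ?_⟩
  · have hr : 0 < √(x ^ 2 - t ^ 2) := Real.sqrt_pos.2 (sub_pos.2 h)
    rw [Salpeter.besselK_one_eq_seriesK1 (by simpa using mul_pos hm hr), Complex.ofReal_mul]
    exact Salpeter.isPropagatorValue_of_tendsto_sqrt hm (Complex.ofReal_mem_slitPlane.2 hr)
      (Salpeter.tendsto_sqrt_of_sq_lt_sq h)
  · have hr : 0 < √(t ^ 2 - x ^ 2) := Real.sqrt_pos.2 (sub_pos.2 h)
    have hslit : Complex.I * √(t ^ 2 - x ^ 2) ∈ Complex.slitPlane :=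
      Complex.mem_slitPlane_iff.2 (.inr (by simpa using hr.ne'))
    convert Salpeter.isPropagatorValue_of_tendsto_sqrt hm hslit
      (Salpeter.tendsto_sqrt_of_sq_lt_sq_of_pos ht h) using 1
    rw [mul_left_comm (m : ℂ), ← Complex.ofReal_mul m √(t ^ 2 - x ^ 2),
      Salpeter.seriesK1_I_mul (mul_pos hm hr), neg_mul m]
    field_simp [Complex.ofReal_ne_zero.2 hr.ne', Complex.ofReal_ne_zero.2 Real.pi_ne_zero]
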